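/- Let $\mathcal{X}$ be a set, $\mathcal{Y}=\{+1,-1\}$, let $\mathcal{H}\subseteq\mathcal{Y}^{\mathcal{X}}$ be a non-empty hypothesis class, let $n\ge 0$ be an integer and let $T=(x_1,\dots,x_n)\in\mathcal{X}^n$ be a sample (repetitions allowed). Write $\mathcal{H}|_T=\{(h(x_1),\dots,h(x_n)):h\in\mathcal{H}\}\subseteq\mathcal{Y}^n$. The agnostic one-inclusion graph has vertex set $V=\mathcal{Y}^n$ and an undirected edge between $u$ and $v$ whenever $\|u-v\|_0=1$, where $\|u-v\|_0=|\{i:u_i\ne v_i\}|$ is the Hamming distance. For non-empty $U\subseteq V$ let $E(U,U)$ be the set of edges with both endpoints in $U$ and define the discounted edge density $$\Phi_{\mathrm{discounted}}(U)=\frac{|E(U,U)|-\sum_{u\in U}\min_{v\in\mathcal{H}|_T}\|u-v\|_0}{|U|}.$$ Let $$\hat{\Re}_T(\mathcal{H}|_T)=\frac1n\,\mathbb{E}_{\sigma}\Big[\sup_{h\in\mathcal{H}|_T}\sum_{i=1}^n\sigma_i h_i\Big],\qquad \sigma \text{ uniform on } \{+1,-1\}^n,$$ be the empirical Rademacher complexity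 (read as $0$ when $n=0$). Then $$\Phi_{\mathrm{discounted}}(V)=\frac n2\cdot\hat{\Re}_T(\mathcal{H}|_T).$$ Moreover, if the VC dimension $\operatorname{VC}(\mathcal{H})$ (the supremum of the sizes of finite sets $S\subseteq\mathcal{X}$ on which $\mathcal{H}$ realizes all $2^{|S|}$ labelings) is finite, then $$\Phi_{\mathrm{discounted}}(V)\le 16\sqrt{n\cdot\operatorname{VC}(\mathcal{H})}.$$ -/

import Mathlib

namespace AgnosticOIG

open scoped BigOperators

/-- A labeling of `n` data points. The label set `{+1, -1}` is the group of units of `ℤ`,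
whose only elements are `1` and `-1`. -/
abbrev Labeling (n : ℕ) : Type := Fin n → ℤˣ

/-- The restriction `H|_T` of a hypothesis class to a sample `T ∈ X^n`. -/
def restrict {X : Type*} (H : Set (X → ℤˣ)) {n : ℕ} (T : Fin n → X) : Set (Labeling n) :=
  {v | ∃ h ∈ H, v = fun i => h (T i)}

/-- `H` shatters the finite set `S` if every labeling of `S` is realized by some `h ∈ H`. -/
def Shatters {X : Type*} (H : Set (X → ℤˣ)) (S : Finset X) : Prop :=
  ∀ y : S → ℤˣ, ∃ h ∈ H, ∀ x : S, h x = y x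

/-- The VC dimension: the supremum (possibly infinite) of the sizes of shattered finite sets. -/
noncomputable def vcDim {X : Type*} (H : Set (X → ℤˣ)) : ℕ∞ :=
  ⨆ (S : Finset X) (_ : Shatters H S), (S.card : ℕ∞)

/-- The agnostic one-inclusion graph on all labelings of `n` points: two labelings are adjacent
iff their Hamming distance is one. -/
def graph (n : ℕ) : SimpleGraph (Labeling n) where
  Adj u v := hammingDist u v = 1
  symm := ⟨fun u v h => by rwa [hammingDist_comm]⟩
  loopless := ⟨fun u h => by simp at h⟩

/-- The (undirected) edges of the agnostic one-inclusion graph with both endpoints in `U`. -/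
def edgesWithin {n : ℕ} (U : Finset (Labeling n)) : Set (Sym2 (Labeling n)) :=
  {e | e ∈ (graph n).edgeSet ∧ ∀ v ∈ e, v ∈ U}

/-- The credit of a vertex `u`: the least Hamming distance from `u` to a labeling in `A`
(a minimum whenever `A` is nonempty). -/
noncomputable def credit {n : ℕ} (A : Set (Labeling n)) (u : Labeling n) : ℕ :=
  sInf ((fun v => hammingDist u v) '' A)

/-- The discounted edge density of a set `U` of vertices, with respect to the set `A` of
realizable labelings. -/
noncomputable def discountedDensity {n : ℕ} (A : Set (Labeling n)) (U : Finset (Labeling n)) : ℝ :=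
  (((edgesWithin U).ncard : ℝ) - ∑ u ∈ U, (credit A u : ℝ)) / (U.card : ℝ)

/-- The empirical Rademacher complexity of a set `A` of labelings of `n` points; `Finset.expect`
is the average over the uniformly distributed sign vector `σ`. -/
noncomputable def rademacher {n : ℕ} (A : Set (Labeling n)) : ℝ :=
  (1 / (n : ℝ)) * Finset.expect Finset.univ (fun σ : Labeling n =>
    ⨆ h : A, ∑ i : Fin n, ((σ i : ℤ) : ℝ) * (((h : Labeling n) i : ℤ) : ℝ))

end AgnosticOIG

/-!
For sign vectors, `⟨σ, h⟩ = n - 2 ‖σ - h‖₀`, so the supremum over `h ∈ H|_T` is `n` minus twice the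
credit of `σ`. The cube has `n 2ⁿ⁻¹` edges, so its discounted density is `n / 2` minus the mean
credit, which is half of the mean supremum.

The VC bound is Dudley's chaining argument along maximal `4⁻ʲ`-separated subsets of `H|_T`, for
the normalized Hamming distance, with Massart's lemma on each scale. A separated set with `N`
elements stays injective on some sample of about `log N / ε` coordinates, where the Sauer–Shelah
lemma bounds `N` independently of `n`. The logarithmic loss in the resulting packing bound is
summable along the chain, so a factor `√(log n)` never appears.
-/

namespace AgnosticOIG

open Finset Matrix
open scoped BigOperators NNReal

variable {ι κ : Type*} [Fintype ι]

section SignVector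

/-- A labeling viewed as a vector of `{±1}^ι ⊆ ℝ^ι`. -/
def signVector (u : ι → ℤˣ) : ι → ℝ := fun i => ((u i : ℤ) : ℝ)

theorem signVector_dotProduct_signVector (u v : ι → ℤˣ) :
    signVector u ⬝ᵥ signVector v = Fintype.card ι - 2 * (hammingDist u v : ℝ) := by
  have hcoord (i : ι) :
      signVector u i * signVector v i = 1 - 2 * (if u i ≠ v i then 1 else 0) := by
    rcases Int.units_eq_one_or (u i) with hu | hu <;>
      rcases Int.units_eq_one_or (v i) with hv | hv <;>
      norm_num [signVector, hu, hv]
  simp only [dotProduct, hcoord, sum_sub_distrib, ← mul_sum, sum_boole, hammingDist]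
  simp

theorem signVector_sub_dotProduct_self (u v : ι → ℤˣ) :
    (signVector u - signVector v) ⬝ᵥ (signVector u - signVector v) = 4 * hammingDist u v := by
  simp only [sub_dotProduct, dotProduct_sub, signVector_dotProduct_signVector, hammingDist_self,
    hammingDist_comm v u]
  push_cast
  ring

theorem card_filter_hammingDist_eq [DecidableEq ι] (u : ι → ℤˣ) (k : ℕ) :
    #{v : ι → ℤˣ | hammingDist u v = k} = (Fintype.card ι).choose k := by
  have hne (a : ℤˣ) : a ≠ -a := by revert a; decide
  have hflip (a b : ℤˣ) : a ≠ b → -a = b := by revert a b; decide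
  rw [← card_univ, ← card_powersetCard]
  refine card_nbij' (fun v => ({i | u i ≠ v i} : Finset ι)) (fun s i => if i ∈ s then -u i else u i)
    ?_ ?_ ?_ ?_
  · intro v hv
    simpa [hammingDist] using hv
  · intro s hs
    simpa [hammingDist, ite_eq_iff, hne] using hs
  · intro v _
    ext i : 1
    by_cases hi : u i = v i
    · simp [hi]
    · simpa [hi] using hflip _ _ hi
  · intro s _
    ext i
    by_cases hi : i ∈ s <;> simp [hi, hne]

end SignVector

section RademacherWidth

variable [DecidableEq ι]

/-- The Rademacher width `𝔼 sup_k ⟨σ, x k⟩` of a family of vectors: the unnormalized Rademacher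
complexity. Families rather than sets are used so that increments `x k - y k` stay indexed by
`k`. -/
noncomputable def rademacherWidth (x : κ → ι → ℝ) : ℝ :=
  𝔼 σ : ι → ℤˣ, ⨆ k, signVector σ ⬝ᵥ x k

theorem rademacherWidth_add_le [Finite κ] [Nonempty κ] (x y : κ → ι → ℝ) :
    rademacherWidth (x + y) ≤ rademacherWidth x + rademacherWidth y := by
  rw [rademacherWidth, rademacherWidth, rademacherWidth, ← expect_add_distrib]
  refine expect_le_expect fun σ _ => ciSup_le fun k => ?_
  rw [Pi.add_apply, dotProduct_add]
  exact add_le_add (le_ciSup (f := fun k => signVector σ ⬝ᵥ x k) (Set.finite_range _).bddAbove k)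
    (le_ciSup (f := fun k => signVector σ ⬝ᵥ y k) (Set.finite_range _).bddAbove k)

theorem rademacherWidth_comp_le {κ' : Type*} [Nonempty κ'] [Finite κ] (x : κ → ι → ℝ)
    (f : κ' → κ) : rademacherWidth (x ∘ f) ≤ rademacherWidth x :=
  expect_le_expect fun σ _ => ciSup_le fun k =>
    le_ciSup (f := fun k => signVector σ ⬝ᵥ x k) (Set.finite_range _).bddAbove (f k)

theorem exp_expect_le_expect_exp {α : Type*} [Fintype α] [Nonempty α] (f : α → ℝ) :
    Real.exp (𝔼 a, f a) ≤ 𝔼 a, Real.exp (f a) := by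
  have hJensen := convexOn_exp.map_sum_le (t := univ) (w := fun _ => (Fintype.card α : ℝ)⁻¹)
    (p := f) (fun _ _ => by positivity) (by simp) (by simp)
  simpa only [Fintype.expect_eq_sum_div_card, div_eq_inv_mul, mul_sum, smul_eq_mul] using hJensen

theorem expect_exp_signVector_dotProduct (a : ι → ℝ) :
    𝔼 σ : ι → ℤˣ, Real.exp (signVector σ ⬝ᵥ a) = ∏ i, Real.cosh (a i) := by
  have hcosh (i : ι) : ∑ s : ℤˣ, Real.exp (((s : ℤ) : ℝ) * a i) = 2 * Real.cosh (a i) := by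
    rw [Real.cosh_eq, show (univ : Finset ℤˣ) = {1, -1} from rfl, sum_pair (by decide)]
    simp
    ring
  have hcard : (Fintype.card (ι → ℤˣ) : ℝ) = ∏ _i : ι, (2 : ℝ) := by
    simp [Fintype.card_units_int]
  simp only [Fintype.expect_eq_sum_div_card, dotProduct, signVector, Real.exp_sum]
  rw [← Fintype.prod_sum fun i (s : ℤˣ) => Real.exp (((s : ℤ) : ℝ) * a i)]
  simp only [hcosh, prod_mul_distrib, hcard]
  exact mul_div_cancel_left₀ _ (by simp)

theorem expect_exp_signVector_dotProduct_le (a : ι → ℝ) :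
    𝔼 σ : ι → ℤˣ, Real.exp (signVector σ ⬝ᵥ a) ≤ Real.exp (a ⬝ᵥ a / 2) :=
  calc 𝔼 σ : ι → ℤˣ, Real.exp (signVector σ ⬝ᵥ a)
      = ∏ i, Real.cosh (a i) := expect_exp_signVector_dotProduct a
    _ ≤ ∏ i, Real.exp (a i ^ 2 / 2) :=
        prod_le_prod (fun i _ => (Real.cosh_pos _).le) fun i _ => Real.cosh_le_exp_half_sq _
    _ = Real.exp (a ⬝ᵥ a / 2) := by simp only [← Real.exp_sum, dotProduct, sum_div, sq]

theorem mul_rademacherWidth_le [Finite κ] [Nonempty κ] {x : κ → ι → ℝ} {r : ℝ}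
    (hx : ∀ k, x k ⬝ᵥ x k ≤ r) (t : ℝ) :
    t * rademacherWidth x ≤ Real.log (Nat.card κ) + r / 2 * t ^ 2 := by
  have := Fintype.ofFinite κ
  have hsup (σ : ι → ℤˣ) : Real.exp (t * ⨆ k, signVector σ ⬝ᵥ x k) ≤
      ∑ k, Real.exp (signVector σ ⬝ᵥ (t • x k)) := by
    obtain ⟨k, hk⟩ := exists_eq_ciSup_of_finite (f := fun k => signVector σ ⬝ᵥ x k)
    rw [← hk, ← smul_eq_mul, ← dotProduct_smul]
    exact single_le_sum (f := fun k => Real.exp (signVector σ ⬝ᵥ (t • x k)))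
      (fun _ _ => (Real.exp_pos _).le) (mem_univ k)
  have hmgf (k : κ) :
      𝔼 σ : ι → ℤˣ, Real.exp (signVector σ ⬝ᵥ (t • x k)) ≤ Real.exp (r / 2 * t ^ 2) := by
    refine (expect_exp_signVector_dotProduct_le _).trans (Real.exp_le_exp.2 ?_)
    rw [smul_dotProduct, dotProduct_smul, smul_eq_mul, smul_eq_mul]
    nlinarith [hx k, sq_nonneg t]
  have hcard : (0 : ℝ) < Nat.card κ := by exact_mod_cast Nat.card_pos
  rw [← Real.exp_le_exp, Real.exp_add, Real.exp_log hcard]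
  calc Real.exp (t * rademacherWidth x)
      = Real.exp (𝔼 σ : ι → ℤˣ, t * ⨆ k, signVector σ ⬝ᵥ x k) := by
        rw [rademacherWidth, mul_expect]
    _ ≤ 𝔼 σ : ι → ℤˣ, Real.exp (t * ⨆ k, signVector σ ⬝ᵥ x k) := exp_expect_le_expect_exp _
    _ ≤ 𝔼 σ : ι → ℤˣ, ∑ k, Real.exp (signVector σ ⬝ᵥ (t • x k)) :=
        expect_le_expect fun σ _ => hsup σ
    _ = ∑ k, 𝔼 σ : ι → ℤˣ, Real.exp (signVector σ ⬝ᵥ (t • x k)) := expect_sum_comm _ _ _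
    _ ≤ ∑ _k : κ, Real.exp (r / 2 * t ^ 2) := sum_le_sum fun k _ => hmgf k
    _ = Nat.card κ * Real.exp (r / 2 * t ^ 2) := by simp

/-- Massart's finite class lemma. -/
theorem rademacherWidth_le_sqrt_log_card [Finite κ] [Nonempty κ] {x : κ → ι → ℝ} {r : ℝ}
    (hx : ∀ k, x k ⬝ᵥ x k ≤ r) :
    rademacherWidth x ≤ √(2 * r * Real.log (Nat.card κ)) := by
  -- `mul_rademacherWidth_le` is a quadratic inequality in `t`, so its discriminant is nonpositive.
  have hdiscrim : discrim (r / 2) (-rademacherWidth x) (Real.log (Nat.card κ)) ≤ 0 :=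
    discrim_le_zero fun t => by linarith [mul_rademacherWidth_le hx t]
  rw [discrim] at hdiscrim
  exact Real.le_sqrt_of_sq_le (by linarith)

end RademacherWidth

section Chaining

theorem exists_isSeparated_isCover [Finite κ] (U : SetRel κ κ) [U.IsRefl] [U.IsSymm]
    (A : Set κ) : ∃ N ⊆ A, U.IsSeparated N ∧ U.IsCover A N := by
  obtain ⟨N, hN⟩ := (Set.toFinite {N | N ⊆ A ∧ U.IsSeparated N}).exists_maximal
    ⟨∅, Set.empty_subset A, .empty⟩
  exact ⟨N, hN.1.1, hN.1.2, .of_maximal_isSeparated hN⟩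

variable [DecidableEq ι] [Finite κ] (x : κ → ι → ℝ)

theorem rademacherWidth_le_add_of_isCover {A N : Set κ} (hA : A.Nonempty) {U : SetRel κ κ}
    (hcov : U.IsCover A N) {r : ℝ}
    (hU : ∀ k l, (k, l) ∈ U → (x k - x l) ⬝ᵥ (x k - x l) ≤ r) :
    rademacherWidth (fun k : A => x k) ≤
      rademacherWidth (fun k : N => x k) + √(2 * r * Real.log A.ncard) := by
  have := hA.to_subtype
  have hnear : ∀ k ∈ A, ∃ l ∈ N, (k, l) ∈ U := fun _ hk => hcov hk
  choose! π hπN hπU using hnear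
  let πA : A → N := fun k => ⟨π k, hπN k k.2⟩
  calc rademacherWidth (fun k : A => x k)
      = rademacherWidth ((fun l : N => x l) ∘ πA + fun k : A => x k - x (π k)) := by
        congr 1
        ext k : 1
        simp [πA]
    _ ≤ rademacherWidth ((fun l : N => x l) ∘ πA) +
          rademacherWidth (fun k : A => x k - x (π k)) := rademacherWidth_add_le _ _
    _ ≤ rademacherWidth (fun l : N => x l) + √(2 * r * Real.log A.ncard) :=
        add_le_add (rademacherWidth_comp_le _ πA)
          (rademacherWidth_le_sqrt_log_card fun k => hU _ _ (hπU k k.2))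

/-- A discrete form of Dudley's entropy bound. -/
theorem rademacherWidth_le_sum_sqrt {U : ℕ → SetRel κ κ} [∀ j, (U j).IsRefl]
    [∀ j, (U j).IsSymm] {r L : ℕ → ℝ} {A : Set κ}
    (hU : ∀ j k l, (k, l) ∈ U j → (x k - x l) ⬝ᵥ (x k - x l) ≤ r j)
    (hU₀ : ∀ k l, (k, l) ∈ U 0)
    (hL : ∀ j, ∀ P ⊆ A, (U (j + 1)).IsSeparated P → Real.log P.ncard ≤ L j)
    (j : ℕ) {P : Set κ} (hPA : P ⊆ A) (hP : P.Nonempty) (hsep : (U j).IsSeparated P) :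
    rademacherWidth (fun k : P => x k) ≤ ∑ i ∈ range j, √(2 * r i * L i) := by
  induction j generalizing P with
  | zero =>
    have hsub : P.Subsingleton := fun k hk l hl => by
      by_contra hkl
      exact hsep hk hl hkl (hU₀ k l)
    have := hP.to_subtype
    have := hsub.coe_sort
    simpa using rademacherWidth_le_sqrt_log_card (x := fun k : P => x k)
      (r := x hP.some ⬝ᵥ x hP.some) fun k => by rw [hsub k.2 hP.some_mem]
  | succ j ih =>
    obtain ⟨N, hNA, hNsep, hcov⟩ := exists_isSeparated_isCover (U j) A
    have hr : 0 ≤ r j := by simpa using hU j hP.some hP.some (SetRel.rfl _)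
    calc rademacherWidth (fun k : P => x k)
        ≤ rademacherWidth (fun k : N => x k) + √(2 * r j * Real.log P.ncard) :=
          rademacherWidth_le_add_of_isCover x hP (hcov.anti hPA) (hU j)
      _ ≤ ∑ i ∈ range j, √(2 * r i * L i) + √(2 * r j * L j) := by
          gcongr
          · exact ih hNA (hcov.nonempty (hP.mono hPA)) hNsep
          · exact hL j P hPA hsep
      _ = ∑ i ∈ range (j + 1), √(2 * r i * L i) := (sum_range_succ _ j).symm

end Chaining

section Subsampling

variable {β : Type*} [DecidableEq β]

/-- The relation of agreeing up to a fraction `ε` of the coordinates; `ε` is taken in `ℝ≥0` so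
that the relation is always reflexive. -/
def hammingRel (ι β : Type*) [Fintype ι] [DecidableEq β] (ε : ℝ≥0) :
    SetRel (ι → β) (ι → β) :=
  {p | (hammingDist p.1 p.2 : ℝ) ≤ ε * Fintype.card ι}

instance (ε : ℝ≥0) : (hammingRel ι β ε).IsRefl where
  refl u := by
    simp only [hammingRel, Set.mem_ofPred_eq, hammingDist_self, Nat.cast_zero]
    positivity

instance (ε : ℝ≥0) : (hammingRel ι β ε).IsSymm where
  symm u v huv := by simpa only [hammingRel, Set.mem_ofPred_eq, hammingDist_comm] using huv

variable [Fintype κ]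

theorem card_filter_comp_eq_comp [DecidableEq κ] (u v : ι → β) :
    #{f : κ → ι | u ∘ f = v ∘ f} = (Fintype.card ι - hammingDist u v) ^ Fintype.card κ := by
  have hpi : ({f : κ → ι | u ∘ f = v ∘ f} : Finset (κ → ι)) =
      Fintype.piFinset fun _ => {i | u i = v i} := by
    ext f
    simp [funext_iff]
  have hagree : #{i | u i = v i} + hammingDist u v = Fintype.card ι :=
    card_filter_add_card_filter_not fun i => u i = v i
  rw [hpi, Fintype.card_piFinset, prod_const, card_univ, ← hagree, Nat.add_sub_cancel]

theorem card_filter_comp_eq_comp_le [DecidableEq κ] {u v : ι → β} {ε : ℝ≥0}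
    (huv : (u, v) ∉ hammingRel ι β ε) :
    (#{f : κ → ι | u ∘ f = v ∘ f} : ℝ) ≤
      Fintype.card ι ^ Fintype.card κ * Real.exp (-(ε * Fintype.card κ)) := by
  have hfar : ε * Fintype.card ι < (hammingDist u v : ℝ) := not_le.1 huv
  have hagree : (Fintype.card ι : ℝ) - hammingDist u v ≤ Fintype.card ι * Real.exp (-ε) := by
    nlinarith [Real.add_one_le_exp (-ε : ℝ), (Nat.cast_nonneg _ : (0 : ℝ) ≤ Fintype.card ι)]
  rw [card_filter_comp_eq_comp, Nat.cast_pow, Nat.cast_sub hammingDist_le_card_fintype]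
  calc ((Fintype.card ι : ℝ) - hammingDist u v) ^ Fintype.card κ
      ≤ (Fintype.card ι * Real.exp (-ε)) ^ Fintype.card κ := by
        gcongr
        exact sub_nonneg.2 (by exact_mod_cast hammingDist_le_card_fintype)
    _ = Fintype.card ι ^ Fintype.card κ * Real.exp (-(ε * Fintype.card κ)) := by
        rw [mul_pow, ← Real.exp_nat_mul, mul_neg, mul_comm (Fintype.card κ : ℝ)]

theorem sum_card_filter_comp_eq_comp_lt [DecidableEq κ] [Nonempty ι] {B : Finset (ι → β)}
    (hB₀ : B.Nonempty) {ε : ℝ≥0} (hB : (hammingRel ι β ε).IsSeparated B)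
    (hκ : 2 * Real.log #B ≤ ε * Fintype.card κ) :
    ∑ p ∈ B.offDiag, #{f : κ → ι | p.1 ∘ f = p.2 ∘ f} < Fintype.card (κ → ι) := by
  have hpairs : (#B.offDiag : ℝ) < #B ^ 2 := by
    rw [offDiag_card, sq]
    exact_mod_cast Nat.sub_lt (Nat.mul_pos hB₀.card_pos hB₀.card_pos) hB₀.card_pos
  have hexp : (#B : ℝ) ^ 2 * Real.exp (-(ε * Fintype.card κ)) ≤ 1 := by
    have hsq : (#B : ℝ) ^ 2 = Real.exp (2 * Real.log #B) := by
      rw [two_mul, Real.exp_add, Real.exp_log (by exact_mod_cast hB₀.card_pos), sq]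
    rw [hsq, ← Real.exp_add, Real.exp_le_one_iff]
    linarith
  rw [Fintype.card_fun, ← Nat.cast_lt (α := ℝ)]
  push_cast
  calc ∑ p ∈ B.offDiag, (#{f : κ → ι | p.1 ∘ f = p.2 ∘ f} : ℝ)
      ≤ ∑ _p ∈ B.offDiag,
          (Fintype.card ι ^ Fintype.card κ * Real.exp (-(ε * Fintype.card κ)) : ℝ) := by
        refine sum_le_sum fun p hp => card_filter_comp_eq_comp_le ?_
        obtain ⟨hu, hv, hne⟩ := mem_offDiag.1 hp
        exact hB hu hv hne
    _ = #B.offDiag * (Fintype.card ι ^ Fintype.card κ * Real.exp (-(ε * Fintype.card κ))) := by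
        rw [sum_const, nsmul_eq_mul]
    _ < #B ^ 2 * (Fintype.card ι ^ Fintype.card κ * Real.exp (-(ε * Fintype.card κ))) := by
        gcongr
    _ = Fintype.card ι ^ Fintype.card κ * (#B ^ 2 * Real.exp (-(ε * Fintype.card κ))) := by ring
    _ ≤ Fintype.card ι ^ Fintype.card κ := mul_le_of_le_one_right (by positivity) hexp

/-- The probabilistic method: a uniformly random sample of coordinates fails to distinguish a given
pair of `B` with probability at most `exp (-ε |κ|)`, and there are fewer than `|B|²` pairs. -/
theorem exists_injOn_comp [Nonempty ι] {B : Finset (ι → β)} {ε : ℝ≥0}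
    (hB : (hammingRel ι β ε).IsSeparated B)
    (hκ : 2 * Real.log #B ≤ ε * Fintype.card κ) :
    ∃ f : κ → ι, Set.InjOn (fun u : ι → β => u ∘ f) B := by
  classical
  rcases B.eq_empty_or_nonempty with rfl | hB₀
  · exact ⟨fun _ => Classical.arbitrary ι, by simp⟩
  by_contra! hcollide
  have hcover : (univ : Finset (κ → ι)) ⊆
      B.offDiag.biUnion fun p => {f : κ → ι | p.1 ∘ f = p.2 ∘ f} := by
    intro f _
    obtain ⟨u, hu, v, hv, huv, hne⟩ : ∃ u ∈ B, ∃ v ∈ B, u ∘ f = v ∘ f ∧ u ≠ v := by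
      simpa [Set.InjOn] using hcollide f
    exact mem_biUnion.2 ⟨(u, v), mem_offDiag.2 ⟨hu, hv, hne⟩, by simpa using huv⟩
  exact (sum_card_filter_comp_eq_comp_lt hB₀ hB hκ).not_ge
    ((card_le_card hcover).trans card_biUnion_le)

end Subsampling

section VCDimension

/-- The set of points labeled `+1`, through which classes of labelings become set families. -/
def positives (u : ι → ℤˣ) : Finset ι := {i | u i = 1}

theorem eq_of_eq_one_iff {a b : ℤˣ} (h : a = 1 ↔ b = 1) : a = b := by
  revert a b; decide

theorem positives_injective : Function.Injective (positives : (ι → ℤˣ) → Finset ι) :=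
  fun u v huv => funext fun i =>
    eq_of_eq_one_iff (by simpa [positives] using Finset.ext_iff.1 huv i)

theorem card_mul_pow_vcDim_le [DecidableEq ι] (𝒜 : Finset (Finset ι)) {t : ℝ} (ht₀ : 0 ≤ t)
    (ht₁ : t ≤ 1) : #𝒜 * t ^ 𝒜.vcDim ≤ (1 + t) ^ Fintype.card ι :=
  calc #𝒜 * t ^ 𝒜.vcDim ≤ (#𝒜.shatterer : ℝ) * t ^ 𝒜.vcDim := by
        gcongr ?_ * _
        exact_mod_cast card_le_card_shatterer 𝒜
    _ = ∑ _s ∈ 𝒜.shatterer, t ^ 𝒜.vcDim := by rw [sum_const, nsmul_eq_mul]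
    _ ≤ ∑ s ∈ 𝒜.shatterer, t ^ #s := sum_le_sum fun s hs =>
        pow_le_pow_of_le_one ht₀ ht₁ (mem_shatterer.1 hs).card_le_vcDim
    _ ≤ ∑ s ∈ (univ : Finset ι).powerset, t ^ #s :=
        sum_le_sum_of_subset_of_nonneg (fun s _ => mem_powerset.2 (subset_univ s))
          fun _ _ _ => by positivity
    _ = (1 + t) ^ Fintype.card ι := by
        simpa [add_comm] using sum_pow_mul_eq_add_pow t 1 (univ : Finset ι)

variable {X : Type*} {H : Set (X → ℤˣ)} {m n d : ℕ}

theorem Shatters.card_le_vcDim {S : Finset X} (hS : Shatters H S) : (#S : ℕ∞) ≤ vcDim H :=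
  le_iSup₂ (f := fun (S : Finset X) (_ : Shatters H S) => (#S : ℕ∞)) S hS

theorem exists_eqOn_of_shatters {T : Fin m → X} {B : Finset (Labeling m)}
    (hB : ↑B ⊆ restrict H T) {s : Finset (Fin m)} (hs : (B.image positives).Shatters s)
    (y : Labeling m) : ∃ h ∈ H, ∀ i ∈ s, h (T i) = y i := by
  obtain ⟨_, hu, hsu⟩ := hs (filter_subset (fun i => y i = 1) s)
  obtain ⟨v, hv, rfl⟩ := mem_image.1 hu
  obtain ⟨h, hh, rfl⟩ := hB hv
  refine ⟨h, hh, fun i hi => eq_of_eq_one_iff ?_⟩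
  simpa [positives, hi] using Finset.ext_iff.1 hsu i

theorem injOn_of_shatters {T : Fin m → X} {B : Finset (Labeling m)}
    (hB : ↑B ⊆ restrict H T) {s : Finset (Fin m)} (hs : (B.image positives).Shatters s) :
    Set.InjOn T s := by
  intro i hi j hj hij
  by_contra hne
  obtain ⟨h, -, hh⟩ := exists_eqOn_of_shatters hB hs (Function.update 1 j (-1))
  have hcontra : (1 : ℤˣ) = -1 := by
    simpa [hne] using (hh i hi).symm.trans ((congrArg h hij).trans (hh j hj))
  exact absurd hcontra (by decide)

theorem shatters_image_of_shatters [DecidableEq X] {T : Fin m → X} {B : Finset (Labeling m)}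
    (hB : ↑B ⊆ restrict H T) {s : Finset (Fin m)} (hs : (B.image positives).Shatters s) :
    Shatters H (s.image T) := by
  intro y
  obtain ⟨h, hh, hhs⟩ := exists_eqOn_of_shatters hB hs
    fun i => if hi : T i ∈ s.image T then y ⟨T i, hi⟩ else 1
  refine ⟨h, hh, fun ⟨x, hx⟩ => ?_⟩
  obtain ⟨i, hi, rfl⟩ := mem_image.1 hx
  exact (hhs i hi).trans (dif_pos hx)

theorem vcDim_image_positives_le (hd : vcDim H ≤ d) {T : Fin m → X} {B : Finset (Labeling m)}
    (hB : ↑B ⊆ restrict H T) : (B.image positives).vcDim ≤ d := by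
  classical
  refine Finset.sup_le fun s hs => ?_
  have hshat := mem_shatterer.1 hs
  rw [← card_image_of_injOn (injOn_of_shatters hB hshat)]
  exact_mod_cast (shatters_image_of_shatters hB hshat).card_le_vcDim.trans hd

theorem log_card_le_of_subset_restrict (hd : vcDim H ≤ d) {T : Fin m → X}
    {B : Finset (Labeling m)} (hB : ↑B ⊆ restrict H T) (hB₀ : B.Nonempty) {t : ℝ} (ht₀ : 0 < t)
    (ht₁ : t ≤ 1) : Real.log #B ≤ d * Real.log t⁻¹ + m * t := by
  have hBpos : (0 : ℝ) < #B := by exact_mod_cast hB₀.card_pos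
  have hsauer : #B * t ^ d ≤ Real.exp (m * t) :=
    calc #B * t ^ d ≤ #(B.image positives) * t ^ (B.image positives).vcDim := by
          rw [card_image_of_injective B positives_injective]
          gcongr ?_ * ?_
          exact pow_le_pow_of_le_one ht₀.le ht₁ (vcDim_image_positives_le hd hB)
      _ ≤ (1 + t) ^ m := by simpa using card_mul_pow_vcDim_le (B.image positives) ht₀.le ht₁
      _ ≤ Real.exp (m * t) := by
          rw [Real.exp_nat_mul, add_comm]
          gcongr
          exact Real.add_one_le_exp t
  have hlog := Real.log_le_log (by positivity) hsauer
  rw [Real.log_exp, Real.log_mul hBpos.ne' (by positivity), Real.log_pow] at hlog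
  rw [Real.log_inv]
  linarith

theorem log_card_le_of_isSeparated [Nonempty (Fin n)] (hd : vcDim H ≤ d) {T : Fin n → X}
    {B : Finset (Labeling n)} (hB : ↑B ⊆ restrict H T) (hB₀ : B.Nonempty) {ε : ℝ≥0}
    (hsep : (hammingRel (Fin n) ℤˣ ε).IsSeparated B) (hm : 2 * Real.log #B ≤ ε * m) {t : ℝ}
    (ht₀ : 0 < t) (ht₁ : t ≤ 1) : Real.log #B ≤ d * Real.log t⁻¹ + m * t := by
  classical
  obtain ⟨f, hf⟩ := exists_injOn_comp (κ := Fin m) hsep (by simpa using hm)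
  have hsub : ↑(B.image fun u => u ∘ f) ⊆ restrict H (T ∘ f) := by
    rw [coe_image, Set.image_subset_iff]
    intro u hu
    obtain ⟨h, hh, rfl⟩ := hB hu
    exact ⟨h, hh, rfl⟩
  rw [← card_image_of_injOn hf]
  exact log_card_le_of_subset_restrict hd hsub (hB₀.image _) ht₀ ht₁

theorem exists_nat_mul_mem_Icc {a ε : ℝ} (hε : 0 < ε) (hεa : ε ≤ a) :
    ∃ m : ℕ, ε * m ∈ Set.Icc a (2 * a) := by
  refine ⟨⌈a / ε⌉₊, (div_le_iff₀' hε).1 (Nat.le_ceil _), ?_⟩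
  have ha : 0 ≤ a / ε := div_nonneg (hε.le.trans hεa) hε.le
  calc ε * ⌈a / ε⌉₊ ≤ ε * (a / ε + 1) := by gcongr; exact (Nat.ceil_lt_add_one ha).le
    _ = a + ε := by field_simp
    _ ≤ 2 * a := by linarith

/-- Haussler's packing bound, up to a logarithmic factor. -/
theorem log_ncard_le_of_isSeparated (hd : vcDim H ≤ d) {T : Fin n → X} {P : Set (Labeling n)}
    (hP : P ⊆ restrict H T) {ε : ℝ≥0} (hε₀ : 0 < ε) (hε₁ : ε ≤ 1)
    (hsep : (hammingRel (Fin n) ℤˣ ε).IsSeparated P) :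
    Real.log P.ncard ≤ 2 * d * Real.log (8 / ε) := by
  lift P to Finset (Labeling n) using P.toFinite
  rw [Set.ncard_coe_finset]
  have hε₀' : (0 : ℝ) < ε := hε₀
  have hε₁' : (ε : ℝ) ≤ 1 := hε₁
  rcases le_or_gt #P 1 with hcard | hcard
  · have hlog : Real.log #P ≤ 0 :=
      Real.log_nonpos (Nat.cast_nonneg _) (by exact_mod_cast hcard)
    have : 0 ≤ Real.log (8 / ε) :=
      Real.log_nonneg ((one_le_div₀ hε₀').2 (hε₁'.trans (by norm_num)))
    exact hlog.trans (by positivity)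
  obtain ⟨u, hu, v, -, huv⟩ := one_lt_card.1 hcard
  have : Nonempty (Fin n) := (Function.ne_iff.1 huv).nonempty
  have hlog : 1 / 2 < Real.log #P := by
    have : Real.log 2 ≤ Real.log #P := Real.log_le_log two_pos (by exact_mod_cast hcard)
    linarith [Real.log_two_gt_d9]
  obtain ⟨m, hm, hm'⟩ := exists_nat_mul_mem_Icc (a := 2 * Real.log #P) hε₀' (by linarith)
  have hm₀ : (0 : ℝ) < m := pos_of_mul_pos_right (by linarith) ε.coe_nonneg
  -- With this `t` the term `m * t` of the Sauer–Shelah bound is half of the left-hand side.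
  set t := Real.log #P / (2 * m) with ht
  have ht₁ : t ≤ 1 := by
    rw [ht, div_le_one (by positivity)]
    nlinarith
  have hbound := log_card_le_of_isSeparated hd hP ⟨u, hu⟩ hsep hm (by positivity) ht₁
  have hmt : m * t = Real.log #P / 2 := by rw [ht]; field_simp
  have htinv : Real.log t⁻¹ ≤ Real.log (8 / ε) := by
    refine Real.log_le_log (by positivity) ?_
    rw [ht, inv_div, div_le_div_iff₀ (by positivity) hε₀']
    linarith
  nlinarith [(Nat.cast_nonneg d : (0 : ℝ) ≤ d)]

theorem sum_add_two_mul_inv_two_pow (j : ℕ) :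
    ∑ i ∈ range j, ((i : ℝ) + 2) * 2⁻¹ ^ i = 6 - (2 * j + 6) * 2⁻¹ ^ j := by
  induction j with
  | zero => norm_num
  | succ j ih =>
    rw [sum_range_succ, ih]
    push_cast
    ring

theorem log_ncard_le_of_isSeparated_inv_four_pow (hd : vcDim H ≤ d) {T : Fin n → X}
    {P : Set (Labeling n)} (hP : P ⊆ restrict H T) {j : ℕ}
    (hsep : (hammingRel (Fin n) ℤˣ (4⁻¹ ^ (j + 1))).IsSeparated P) :
    Real.log P.ncard ≤ 2 * d * ((j : ℝ) + 2) ^ 2 := by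
  refine (log_ncard_le_of_isSeparated hd hP (by positivity)
    (pow_le_one₀ (by positivity) (inv_le_one_of_one_le₀ (by norm_num))) hsep).trans ?_
  gcongr
  have hpow : (8 : ℝ) / ((4⁻¹ ^ (j + 1) : ℝ≥0) : ℝ) = 2 ^ (2 * j + 5) := by
    push_cast
    rw [inv_pow, div_inv_eq_mul, show (4 : ℝ) = 2 ^ 2 by norm_num, ← pow_mul]
    ring
  rw [hpow, Real.log_pow]
  push_cast
  nlinarith [Real.log_two_lt_d9, (Nat.cast_nonneg j : (0 : ℝ) ≤ j)]

theorem restrict_nonempty (hH : H.Nonempty) (T : Fin n → X) : (restrict H T).Nonempty :=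
  let ⟨h, hh⟩ := hH
  ⟨fun i => h (T i), h, hh, rfl⟩

theorem isSeparated_inv_four_pow (A : Set (Labeling n)) :
    (hammingRel (Fin n) ℤˣ (4⁻¹ ^ n)).IsSeparated A := by
  intro u _ v _ huv
  have hdist : (1 : ℝ) ≤ hammingDist u v := by exact_mod_cast hammingDist_pos.2 huv
  have hscale : (4 : ℝ)⁻¹ ^ n * n < 1 := by
    rw [inv_pow, inv_mul_lt_one₀ (by positivity)]
    exact_mod_cast Nat.lt_pow_self (by norm_num : 1 < 4)
  simpa [hammingRel] using hscale.trans_le hdist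

theorem rademacherWidth_restrict_le (hd : vcDim H ≤ d) (hH : H.Nonempty) (T : Fin n → X) :
    rademacherWidth (fun v : restrict H T => signVector (v : Labeling n)) ≤ 24 * √(n * d) := by
  have hterm (i : ℕ) : √(2 * (4 * (4⁻¹ ^ i * n)) * (2 * d * ((i : ℝ) + 2) ^ 2)) =
      4 * √(n * d) * (((i : ℝ) + 2) * 2⁻¹ ^ i) := by
    have hsq : 2 * (4 * (4⁻¹ ^ i * n)) * (2 * d * ((i : ℝ) + 2) ^ 2) =
        n * d * (4 * (((i : ℝ) + 2) * 2⁻¹ ^ i)) ^ 2 := by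
      rw [show (4 : ℝ)⁻¹ = 2⁻¹ ^ 2 by norm_num, pow_right_comm]
      ring
    rw [hsq, Real.sqrt_mul (by positivity), Real.sqrt_sq (by positivity)]
    ring
  calc rademacherWidth (fun v : restrict H T => signVector (v : Labeling n))
      ≤ ∑ i ∈ range n, √(2 * (4 * (4⁻¹ ^ i * n)) * (2 * d * ((i : ℝ) + 2) ^ 2)) :=
        rademacherWidth_le_sum_sqrt signVector (U := fun j => hammingRel (Fin n) ℤˣ (4⁻¹ ^ j))
          (fun j u v huv => by
            rw [signVector_sub_dotProduct_self]
            gcongr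
            simpa [hammingRel] using huv)
          (fun u v => by simpa [hammingRel] using hammingDist_le_card_fintype (x := u) (y := v))
          (fun j P hP hsep => log_ncard_le_of_isSeparated_inv_four_pow hd hP hsep)
          n subset_rfl (restrict_nonempty hH T) (isSeparated_inv_four_pow _)
    _ = 4 * √(n * d) * (6 - (2 * n + 6) * 2⁻¹ ^ n) := by
        simp only [hterm, ← mul_sum, sum_add_two_mul_inv_two_pow]
    _ ≤ 4 * √(n * d) * 6 := by
        gcongr
        exact sub_le_self _ (by positivity)
    _ = 24 * √(n * d) := by ring

end VCDimension

section OneInclusionGraph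

variable {n : ℕ} {A : Set (Labeling n)}

theorem two_mul_ncard_edgesWithin_univ (n : ℕ) :
    2 * (edgesWithin (univ : Finset (Labeling n))).ncard = n * Fintype.card (Labeling n) := by
  classical
  have hdeg (u : Labeling n) : (graph n).degree u = n := by
    have hsphere : (graph n).neighborFinset u = ({v | hammingDist u v = 1} : Finset _) := by
      ext v
      rw [SimpleGraph.mem_neighborFinset, mem_filter_univ]
      rfl
    rw [← SimpleGraph.card_neighborFinset_eq_degree, hsphere, card_filter_hammingDist_eq,
      Fintype.card_fin, Nat.choose_one_right]
  have hedges : edgesWithin (univ : Finset (Labeling n)) = (graph n).edgeFinset := by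
    ext e
    simp [edgesWithin]
  rw [hedges, Set.ncard_coe_finset, ← SimpleGraph.sum_degrees_eq_twice_card_edges]
  simp [hdeg, mul_comm]

theorem discountedDensity_univ (A : Set (Labeling n)) :
    discountedDensity A univ = n / 2 - 𝔼 u, (credit A u : ℝ) := by
  have hedges : 2 * ((edgesWithin (univ : Finset (Labeling n))).ncard : ℝ) =
      n * Fintype.card (Labeling n) := by
    exact_mod_cast two_mul_ncard_edgesWithin_univ n
  have hcard : (Fintype.card (Labeling n) : ℝ) ≠ 0 := by
    exact_mod_cast Fintype.card_ne_zero
  rw [discountedDensity, Fintype.expect_eq_sum_div_card, card_univ]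
  field_simp
  linarith

theorem iSup_signVector_dotProduct (hA : A.Nonempty) (σ : Labeling n) :
    ⨆ v : A, signVector σ ⬝ᵥ signVector (v : Labeling n) = n - 2 * (credit A σ : ℝ) := by
  simp only [signVector_dotProduct_signVector, Fintype.card_fin]
  obtain ⟨v, hvA, hv⟩ := Nat.sInf_mem (hA.image fun v => hammingDist σ v)
  refine IsGreatest.csSup_eq ⟨⟨⟨v, hvA⟩, by simp only [hv, credit]⟩, ?_⟩
  rintro _ ⟨w, rfl⟩
  have hcredit : (credit A σ : ℝ) ≤ hammingDist σ (w : Labeling n) := by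
    exact_mod_cast Nat.sInf_le (Set.mem_image_of_mem _ w.2)
  dsimp only
  linarith

theorem rademacherWidth_eq_sub_credit (hA : A.Nonempty) :
    rademacherWidth (fun v : A => signVector (v : Labeling n)) =
      n - 2 * 𝔼 σ, (credit A σ : ℝ) := by
  simp only [rademacherWidth, iSup_signVector_dotProduct hA, expect_sub_distrib,
    Fintype.expect_const, ← mul_expect]

theorem mul_rademacher (A : Set (Labeling n)) :
    n * rademacher A = rademacherWidth (fun v : A => signVector (v : Labeling n)) := by
  have hwidth : rademacher A =
    1 / n * rademacherWidth (fun v : A => signVector (v : Labeling n)) := rfl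
  rcases eq_or_ne n 0 with rfl | hn
  · simp [rademacherWidth, Real.iSup_const_zero]
  · rw [hwidth]
    field_simp

theorem discountedDensity_univ_eq_half_rademacherWidth (hA : A.Nonempty) :
    discountedDensity A univ =
      rademacherWidth (fun v : A => signVector (v : Labeling n)) / 2 := by
  rw [discountedDensity_univ, rademacherWidth_eq_sub_credit hA]
  ring

end OneInclusionGraph

end AgnosticOIG

theorem mainTheorem4 {X : Type*} (H : Set (X → ℤˣ)) (hH : H.Nonempty) (n : ℕ) (T : Fin n → X) :
    AgnosticOIG.discountedDensity (AgnosticOIG.restrict H T) Finset.univ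
        = (n : ℝ) / 2 * AgnosticOIG.rademacher (AgnosticOIG.restrict H T) ∧
      (AgnosticOIG.vcDim H ≠ ⊤ →
        AgnosticOIG.discountedDensity (AgnosticOIG.restrict H T) Finset.univ
          ≤ 16 * Real.sqrt ((n : ℝ) * ((AgnosticOIG.vcDim H).toNat : ℝ))) := by
  rw [AgnosticOIG.discountedDensity_univ_eq_half_rademacherWidth
    (AgnosticOIG.restrict_nonempty hH T)]
  refine ⟨by rw [← AgnosticOIG.mul_rademacher]; ring, fun hvc => ?_⟩
  have hwidth := AgnosticOIG.rademacherWidth_restrict_le (ENat.natCast_toNat hvc).ge hH T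
  linarith [Real.sqrt_nonneg ((n : ℝ) * ((AgnosticOIG.vcDim H).toNat : ℝ))]
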